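/- Fix integers $m,p\ge 1$, a complex number $\beta=a+\imath b$ and vectors $\mathbf a_r\in\mathbb C^m$, $\mathbf a_t\in\mathbb C^p$. For every $n$ let $\mathbf S_n\in\mathbb C^{p\times n}$, put $N=mn$, $\mathbf Z=\mathbf Z_n=\mathbf a_r\mathbf a_t^H\mathbf S_n\in\mathbb C^{m\times n}$ and $\mathbf z=\mathrm{vec}(\mathbf Z)$ with entries $z_i=u_i+\imath v_i$, $i=1,\dots,N$. Assume that $\mathrm{tr}(\mathbf Z\mathbf Z^H)=N$ for every $n$ and that the entries $z_i$ are bounded uniformly in $i$ and $n$. Let $\mathbf N_n\in\mathbb C^{m\times n}$ be a random matrix such that the real and imaginary parts of all its entries are mutually independent standard Gaussian random variables. Let $$\mathbf Y=\mathrm{sign}(\mathrm{Re}(\beta\mathbf Z+\mathbf N_n))+\imath\,\mathrm{sign}(\mathrm{Im}(\beta\mathbf Z+\mathbf N_n))$$ (entrywise), $\mathbf y=\mathrm{vec}(\mathbf Y)$, and $$\mathbf w=\mathbf w_n=\frac1{\sqrt N}\begin{bmatrix}\mathrm{Re}(\mathbf z^H\mathbf y)\\ \mathrm{Im}(\mathbf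 z^H\mathbf y)\end{bmatrix}.$$ With $Q(x)=\int_x^\infty\frac1{\sqrt{2\pi}}e^{-t^2/2}\,dt$, $c_i=1-2Q(au_i-bv_i)$ and $d_i=1-2Q(av_i+bu_i)$, let $$\mathbf u_w(\beta)=\frac1{\sqrt N}\begin{bmatrix}\sum_{i=1}^N(c_iu_i+d_iv_i)\\ \sum_{i=1}^N(d_iu_i-c_iv_i)\end{bmatrix},\qquad \boldsymbol\Sigma_w(\beta)=\begin{bmatrix}\sigma_1^2&\sigma_{12}\\ \sigma_{12}&\sigma_2^2\end{bmatrix},$$ $$\sigma_1^2=1-\frac1N\sum_{i=1}^N(c_i^2u_i^2+d_i^2v_i^2),\quad \sigma_2^2=1-\frac1N\sum_{i=1}^N(c_i^2v_i^2+d_i^2u_i^2),\quad \sigma_{12}=\frac1N\sum_{i=1}^N(c_i^2-d_i^2)u_iv_i.$$ Then for every $n\ge1$ the vector $\mathbf w$ is square integrable with mean $\mathbf u_w(\beta)$ and covariance matrix $\boldsymbol\Sigma_w(\beta)$, and $\boldsymbol\Sigma_w(\beta)$ is positive definite. As $n\to\infty$, $\mathbf w$ is asymptotically distributed as the bivariate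 Gaussian $\mathcal N(\mathbf u_w(\beta),\boldsymbol\Sigma_w(\beta))$: the standardized vector $\boldsymbol\Sigma_w(\beta)^{-1/2}(\mathbf w-\mathbf u_w(\beta))$ converges in distribution to $\mathcal N(\mathbf 0,\mathbf I_2)$, and the Lévy–Prokhorov distance between the law of $\mathbf w$ and $\mathcal N(\mathbf u_w(\beta),\boldsymbol\Sigma_w(\beta))$ tends to $0$. -/

import Mathlib

open MeasureTheory ProbabilityTheory Filter Topology Matrix
open scoped MatrixOrder

namespace OneBitRadar

noncomputable section

/-- The Gaussian tail function `Q(x) = ∫_x^∞ (2π)^{-1/2} exp(-t²/2) dt`. -/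
def gaussQ (x : ℝ) : ℝ :=
  ∫ t in Set.Ioi x, 1 / Real.sqrt (2 * Real.pi) * Real.exp (-t ^ 2 / 2)

/-- The noise-free signal `Z = a_r a_tᴴ S` for unit reflectivity. -/
def signal {m p n : ℕ} (aR : Fin m → ℂ) (aT : Fin p → ℂ) (S : Matrix (Fin p) (Fin n) ℂ) :
    Matrix (Fin m) (Fin n) ℂ :=
  vecMulVec aR (star aT) * S

/-- The one-bit quantizer `sign (Re X) + i sign (Im X)`, applied entrywise. -/
def quantize {m n : ℕ} (X : Matrix (Fin m) (Fin n) ℂ) : Matrix (Fin m) (Fin n) ℂ :=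
  X.map fun x => ((Real.sign x.re : ℝ) : ℂ) + Complex.I * ((Real.sign x.im : ℝ) : ℂ)

/-- White Gaussian noise of variance `2`: the real and imaginary parts of all entries are
mutually independent standard Gaussian random variables. -/
structure IsWhiteNoise {m n : ℕ} {Ω : Type*} [MeasurableSpace Ω] (P : Measure Ω)
    (W : Ω → Matrix (Fin m) (Fin n) ℂ) : Prop where
  law_re : ∀ i j, HasLaw (fun ω => (W ω i j).re) (gaussianReal 0 1) P
  law_im : ∀ i j, HasLaw (fun ω => (W ω i j).im) (gaussianReal 0 1) P
  indep : iIndepFun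
    (Sum.elim (fun (k : Fin m × Fin n) ω => (W ω k.1 k.2).re)
      (fun (k : Fin m × Fin n) ω => (W ω k.1 k.2).im)) P

/-- The vector `w = [Re (zᴴ y), Im (zᴴ y)]ᵀ / √N`, where `z = vec Z`, `y = vec Y`, `N = m n`. -/
def wStat {m n : ℕ} (Z Y : Matrix (Fin m) (Fin n) ℂ) : EuclideanSpace ℝ (Fin 2) :=
  !₂[(star (vec Z) ⬝ᵥ vec Y).re / Real.sqrt ((m : ℝ) * n),
     (star (vec Z) ⬝ᵥ vec Y).im / Real.sqrt ((m : ℝ) * n)]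

/-- `c = 1 - 2 Q(a u - b v)` for `β = a + i b` and `z = u + i v`. -/
def cCoef (β z : ℂ) : ℝ := 1 - 2 * gaussQ (β.re * z.re - β.im * z.im)

/-- `d = 1 - 2 Q(a v + b u)` for `β = a + i b` and `z = u + i v`. -/
def dCoef (β z : ℂ) : ℝ := 1 - 2 * gaussQ (β.re * z.im + β.im * z.re)

/-- The mean vector `u_w(β)`. -/
def meanW {m n : ℕ} (β : ℂ) (Z : Matrix (Fin m) (Fin n) ℂ) : EuclideanSpace ℝ (Fin 2) :=
  (1 / Real.sqrt ((m : ℝ) * n)) •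
    !₂[∑ k, (cCoef β (vec Z k) * (vec Z k).re + dCoef β (vec Z k) * (vec Z k).im),
       ∑ k, (dCoef β (vec Z k) * (vec Z k).re - cCoef β (vec Z k) * (vec Z k).im)]

/-- The entry `σ₁²` of the covariance matrix. -/
def sigma1Sq {m n : ℕ} (β : ℂ) (Z : Matrix (Fin m) (Fin n) ℂ) : ℝ :=
  1 - 1 / ((m : ℝ) * n) * ∑ k, (cCoef β (vec Z k) ^ 2 * (vec Z k).re ^ 2
    + dCoef β (vec Z k) ^ 2 * (vec Z k).im ^ 2)

/-- The entry `σ₂²` of the covariance matrix. -/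
def sigma2Sq {m n : ℕ} (β : ℂ) (Z : Matrix (Fin m) (Fin n) ℂ) : ℝ :=
  1 - 1 / ((m : ℝ) * n) * ∑ k, (cCoef β (vec Z k) ^ 2 * (vec Z k).im ^ 2
    + dCoef β (vec Z k) ^ 2 * (vec Z k).re ^ 2)

/-- The entry `σ₁₂ = σ₂₁` of the covariance matrix. -/
def sigma12 {m n : ℕ} (β : ℂ) (Z : Matrix (Fin m) (Fin n) ℂ) : ℝ :=
  1 / ((m : ℝ) * n) * ∑ k, (cCoef β (vec Z k) ^ 2 - dCoef β (vec Z k) ^ 2)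
    * (vec Z k).re * (vec Z k).im

/-- The covariance matrix `Σ_w(β)`. -/
def covW {m n : ℕ} (β : ℂ) (Z : Matrix (Fin m) (Fin n) ℂ) : Matrix (Fin 2) (Fin 2) ℝ :=
  !![sigma1Sq β Z, sigma12 β Z; sigma12 β Z, sigma2Sq β Z]

/-- The standardization `C^{-1/2} (x - u)`; `CFC.sqrt C` is the positive semidefinite square root
of a positive semidefinite matrix `C`. -/
def standardize (u : EuclideanSpace ℝ (Fin 2)) (C : Matrix (Fin 2) (Fin 2) ℝ)
    (x : EuclideanSpace ℝ (Fin 2)) : EuclideanSpace ℝ (Fin 2) :=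
  toEuclideanCLM (𝕜 := ℝ) (CFC.sqrt C)⁻¹ (x - u)

end

end OneBitRadar

-- The statistic `w` is a sum of `2N` independent random signs, each multiplied by a fixed vector of
-- the plane (`wStat_quantize_eq_sum`). A sign with offset `x` has mean `1 - 2 Q(x)` and square `1`
-- almost surely, so its variance is `1 - (1 - 2 Q(x))²`. With independence this gives the mean and
-- the covariance (`meanW_eq_sum`, `covW_eq_sum`).
--
-- Two facts control `Σ_w`. The trace normalization makes the weight vectors a Parseval frame of the
-- plane (`sum_inner_direction_sq`), and bounded entries keep every `Q(x)` away from `0` and `1`.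
-- Hence `δ I ≤ Σ_w ≤ I`, with `δ > 0` independent of `n`. The lower bound gives positive
-- definiteness and keeps `Σ_w^{-1/2}` bounded. Each standardized summand is then `O(1/√N)`, and a
-- Lindeberg-type estimate of the characteristic function (`norm_charFun_standardize_sub_exp_le`)
-- with Lévy's continuity theorem gives the limit.
--
-- Since `u_w` and `Σ_w` vary with `n`, the law of `w` need not converge. The upper bound makes `x ↦
-- u_w + Σ_w^{1/2} x` 1-Lipschitz, so undoing the standardization does not increase the
-- Lévy–Prokhorov distance (`levyProkhorovDist_multivariateGaussian_le`).

namespace OneBitRadar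

noncomputable section

-- Lévy–Prokhorov distance under 1-Lipschitz maps

section LevyProkhorov

variable {E F : Type*} [PseudoEMetricSpace E] [MeasurableSpace E] [OpensMeasurableSpace E]
  [PseudoEMetricSpace F] [MeasurableSpace F] [BorelSpace F]

/-- Pushing forward along a `1`-Lipschitz map does not increase the Lévy-Prokhorov distance. -/
lemma levyProkhorovEDist_map_le {f : E → F} (hf : LipschitzWith 1 f) (μ ν : Measure E) :
    levyProkhorovEDist (μ.map f) (ν.map f) ≤ levyProkhorovEDist μ ν := by
  have hfm : Measurable f := hf.continuous.measurable
  -- Every radius admissible for `μ`, `ν` is admissible for the images: test it on the preimage of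
  -- `B`.
  refine sInf_le_sInf fun ε hε B hB => ?_
  have hsub : Metric.thickening ε.toReal (f ⁻¹' B) ⊆ f ⁻¹' Metric.thickening ε.toReal B := by
    intro x hx
    rw [Metric.mem_thickening_iff_exists_edist_lt] at hx
    obtain ⟨y, hy, hxy⟩ := hx
    refine (Metric.mem_thickening_iff_exists_edist_lt _ _).2 ⟨f y, hy, ?_⟩
    exact (by simpa using hf x y : edist (f x) (f y) ≤ edist x y).trans_lt hxy
  have hT : MeasurableSet (Metric.thickening ε.toReal B) := Metric.isOpen_thickening.measurableSet
  rw [Measure.map_apply hfm hB, Measure.map_apply hfm hB, Measure.map_apply hfm hT,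
    Measure.map_apply hfm hT]
  obtain ⟨h1, h2⟩ := hε _ (hfm hB)
  exact ⟨h1.trans (by gcongr), h2.trans (by gcongr)⟩

lemma levyProkhorovDist_map_le {f : E → F} (hf : LipschitzWith 1 f) (μ ν : Measure E)
    [IsFiniteMeasure μ] [IsFiniteMeasure ν] :
    levyProkhorovDist (μ.map f) (ν.map f) ≤ levyProkhorovDist μ ν :=
  ENNReal.toReal_mono (levyProkhorovEDist_ne_top μ ν) (levyProkhorovEDist_map_le hf μ ν)

end LevyProkhorov

-- The Gaussian tail function

section GaussianTail

lemma gaussQ_eq_measureReal (x : ℝ) : gaussQ x = (gaussianReal 0 1).real (Set.Ioi x) := by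
  rw [measureReal_def, gaussianReal_apply_eq_integral 0 one_ne_zero,
    ENNReal.toReal_ofReal (integral_nonneg fun _ => gaussianPDFReal_nonneg _ _ _)]
  simp [gaussQ, gaussianPDFReal]

lemma gaussQ_antitone : Antitone gaussQ := fun x y hxy => by
  rw [gaussQ_eq_measureReal, gaussQ_eq_measureReal]
  exact measureReal_mono (Set.Ioi_subset_Ioi hxy)

lemma gaussianReal_isOpenPosMeasure : (gaussianReal 0 1).IsOpenPosMeasure :=
  (gaussianReal_absolutelyContinuous' 0 one_ne_zero).isOpenPosMeasure

lemma gaussQ_pos (x : ℝ) : 0 < gaussQ x := by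
  have := gaussianReal_isOpenPosMeasure
  rw [gaussQ_eq_measureReal]
  exact ENNReal.toReal_pos (isOpen_Ioi.measure_pos _ Set.nonempty_Ioi).ne' (measure_ne_top _ _)

lemma gaussQ_lt_one (x : ℝ) : gaussQ x < 1 := by
  have := gaussianReal_isOpenPosMeasure
  have h : 0 < (gaussianReal 0 1).real (Set.Iio x) :=
    ENNReal.toReal_pos (isOpen_Iio.measure_pos _ Set.nonempty_Iio).ne' (measure_ne_top _ _)
  have h1 := measureReal_mono (μ := gaussianReal 0 1) (s₁ := Set.Iio x) (s₂ := (Set.Ioi x)ᶜ)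
    (by intro y; simpa using fun h => le_of_lt h)
  rw [probReal_compl_eq_one_sub measurableSet_Ioi, ← gaussQ_eq_measureReal] at h1
  linarith

/-- The square of `1 - 2 Q` stays away from `1` on bounded sets. -/
lemma exists_sq_one_sub_two_mul_gaussQ_le (M : ℝ) :
    ∃ δ > 0, ∀ x, |x| ≤ M → (1 - 2 * gaussQ x) ^ 2 ≤ 1 - δ := by
  -- From `1 - (1 - 2q)² = 4q(1 - q)`; on `[-M, M]`, monotonicity bounds `q` below by `Q(M)` and `1
  -- - q` by `1 - Q(-M)`.
  refine ⟨4 * (gaussQ M * (1 - gaussQ (-M))), ?_, fun x hx => ?_⟩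
  · have := gaussQ_pos M
    have := gaussQ_lt_one (-M)
    have : 0 < 1 - gaussQ (-M) := by linarith
    positivity
  · have h1 := gaussQ_antitone (abs_le.1 hx).1
    have h2 := gaussQ_antitone (abs_le.1 hx).2
    have h3 := gaussQ_lt_one (-M)
    have h4 := gaussQ_pos x
    have : gaussQ M * (1 - gaussQ (-M)) ≤ gaussQ x * (1 - gaussQ x) :=
      mul_le_mul h2 (by linarith) (by linarith) h4.le
    nlinarith

end GaussianTail

-- Moments of the sign of a shifted Gaussian

section Sign

lemma measurable_sign : Measurable Real.sign := by
  unfold Real.sign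
  exact Measurable.ite measurableSet_Iio measurable_const
    (Measurable.ite measurableSet_Ioi measurable_const measurable_const)

lemma abs_sign_le_one (x : ℝ) : |Real.sign x| ≤ 1 := by
  obtain h | h | h := Real.sign_apply_eq x <;> simp [h]

variable {Ω : Type*} [MeasurableSpace Ω] {P : Measure Ω} {X : Ω → ℝ}

lemma ae_sign_add_sq_eq_one (hX : HasLaw X (gaussianReal 0 1) P) (x : ℝ) :
    ∀ᵐ ω ∂P, Real.sign (x + X ω) ^ 2 = 1 := by
  have : NullSingletonClass (gaussianReal 0 1) := nullSingletonClass_gaussianReal one_ne_zero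
  have h : ∀ᵐ y ∂(gaussianReal 0 1), y ≠ -x := by
    simp [ae_iff, measure_singleton]
  rw [← hX.map_eq] at h
  filter_upwards [ae_of_ae_map hX.aemeasurable h] with ω hω
  have : x + X ω ≠ 0 := fun h0 => hω (by linarith)
  obtain h | h := Real.sign_apply_eq_of_ne_zero _ this <;> simp [h]

lemma integral_sign_add (hX : HasLaw X (gaussianReal 0 1) P) (x : ℝ) :
    ∫ ω, Real.sign (x + X ω) ∂P = 1 - 2 * gaussQ x := by
  have hs : AEStronglyMeasurable (fun y => Real.sign (x + y)) (gaussianReal 0 1) :=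
    (measurable_sign.comp (measurable_const_add x)).aestronglyMeasurable
  have h0 := hX.integral_comp hs
  simp only [Function.comp_def] at h0
  rw [h0]
  -- The formula fails only at `y = -x`, where the sign is `0`; this is a null set.
  have h1 : ∀ᵐ y ∂(gaussianReal 0 1),
      Real.sign (x + y) = 1 - 2 * (Set.Iio (-x)).indicator (fun _ => (1 : ℝ)) y := by
    filter_upwards [ae_sign_add_sq_eq_one HasLaw.id x] with y hy
    by_cases h : y < -x
    · rw [Real.sign_of_neg (by linarith)]
      simp [Set.indicator, h]
      norm_num
    · obtain h' | h' := (not_lt.1 h).eq_or_lt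
      · simp [← h'] at hy
      · rw [Real.sign_of_pos (by linarith)]
        simp [Set.indicator, h]
  have hI : Integrable ((Set.Iio (-x)).indicator (fun _ => (1 : ℝ))) (gaussianReal 0 1) :=
    (integrable_const _).indicator measurableSet_Iio
  rw [integral_congr_ae h1, integral_sub (integrable_const _) (hI.const_mul 2),
    integral_const_mul, integral_indicator_const _ measurableSet_Iio]
  have h2 : (gaussianReal 0 1).real (Set.Iio (-x)) = gaussQ x := by
    rw [gaussQ_eq_measureReal]
    have := gaussianReal_map_neg (μ := 0) (v := 1)
    rw [neg_zero] at this
    conv_rhs => rw [← this, map_measureReal_apply measurable_neg measurableSet_Ioi]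
    congr 1
    ext y
    simp
  simp [h2]

end Sign

-- A Lindeberg estimate for characteristic functions

section CharFun

/-- Exchange the factors one at a time; in the closed unit disc the remaining factors do not enlarge
the error. -/
lemma norm_prod_sub_prod_le {ι : Type*} (s : Finset ι) (a b : ι → ℂ)
    (ha : ∀ i ∈ s, ‖a i‖ ≤ 1) (hb : ∀ i ∈ s, ‖b i‖ ≤ 1) :
    ‖∏ i ∈ s, a i - ∏ i ∈ s, b i‖ ≤ ∑ i ∈ s, ‖a i - b i‖ := by
  classical
  induction s using Finset.induction_on with
  | empty => simp
  | insert j s hj ih =>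
    rw [Finset.prod_insert hj, Finset.prod_insert hj, Finset.sum_insert hj]
    have h1 := ih (fun i hi => ha i (Finset.mem_insert_of_mem hi))
      (fun i hi => hb i (Finset.mem_insert_of_mem hi))
    have h2 : ‖∏ i ∈ s, a i‖ ≤ 1 := by
      rw [norm_prod]
      exact Finset.prod_le_one (fun _ _ => norm_nonneg _)
        fun i hi => ha i (Finset.mem_insert_of_mem hi)
    have h3 := hb j (Finset.mem_insert_self _ _)
    calc ‖a j * ∏ i ∈ s, a i - b j * ∏ i ∈ s, b i‖
        = ‖(a j - b j) * ∏ i ∈ s, a i + b j * (∏ i ∈ s, a i - ∏ i ∈ s, b i)‖ := by ring_nf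
      _ ≤ ‖a j - b j‖ * ‖∏ i ∈ s, a i‖ + ‖b j‖ * ‖∏ i ∈ s, a i - ∏ i ∈ s, b i‖ := by
        rw [← norm_mul, ← norm_mul]; exact norm_add_le _ _
      _ ≤ ‖a j - b j‖ * 1 + 1 * ‖∏ i ∈ s, a i - ∏ i ∈ s, b i‖ := by gcongr
      _ ≤ _ := by linarith

variable {Ω : Type*} [MeasurableSpace Ω] {P : Measure Ω} [IsProbabilityMeasure P]

lemma norm_exp_mul_I_sub_quadratic_le {x h : ℝ} (hx : |x| ≤ h) (h1 : h ≤ 1) :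
    ‖Complex.exp (x * Complex.I) - (1 + x * Complex.I - (x ^ 2 / 2 : ℝ))‖ ≤ h / 2 * x ^ 2 := by
  have hn : ‖(x * Complex.I : ℂ)‖ = |x| := by simp
  -- The remainder after three terms is at most `(2/9)|x|³`, within the required `(h/2) x²`.
  have := Complex.exp_bound (x := x * Complex.I) (by rw [hn]; linarith) (n := 3) (by norm_num)
  rw [hn] at this
  have e : ∑ k ∈ Finset.range 3, (x * Complex.I : ℂ) ^ k / (k.factorial : ℂ)
      = 1 + x * Complex.I - (x ^ 2 / 2 : ℝ) := by
    simp [Finset.sum_range_succ, mul_pow, Nat.factorial]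
    ring
  rw [e] at this
  refine this.trans ?_
  have h3 : |x| ^ 3 = |x| * x ^ 2 := by rw [pow_succ', sq_abs]
  rw [h3]
  have h4 : |x| * x ^ 2 ≤ h * x ^ 2 := by gcongr
  have h5 : 0 ≤ |x| * x ^ 2 := by positivity
  norm_num [Nat.factorial]
  linarith

/-- The characteristic function of a small centered variable is close to the Gaussian one. -/
lemma norm_charFun_sub_exp_le {ξ : Ω → ℝ} (hξ : AEMeasurable ξ P) {h : ℝ} (h1 : h ≤ 1)
    (hb : ∀ᵐ ω ∂P, |ξ ω| ≤ h) (h0 : ∫ ω, ξ ω ∂P = 0) :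
    ‖charFun (P.map ξ) 1 - Complex.exp (-(∫ ω, ξ ω ^ 2 ∂P : ℝ) / 2)‖
      ≤ h * ∫ ω, ξ ω ^ 2 ∂P := by
  have hh : 0 ≤ h := by
    obtain ⟨ω, hω⟩ := hb.exists
    exact (abs_nonneg _).trans hω
  set s := ∫ ω, ξ ω ^ 2 ∂P with hs
  have hi1 : Integrable ξ P := .of_bound hξ.aestronglyMeasurable h (by simpa using hb)
  have hsq : ∀ᵐ ω ∂P, ξ ω ^ 2 ≤ h ^ 2 := by
    filter_upwards [hb] with ω hω
    exact sq_le_sq' (abs_le.1 hω).1 (abs_le.1 hω).2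
  have hi2 : Integrable (fun ω => ξ ω ^ 2) P :=
    .of_bound (hξ.pow_const 2).aestronglyMeasurable (h ^ 2) (by simpa using hsq)
  have hs0 : 0 ≤ s := integral_nonneg fun _ => sq_nonneg _
  have hsh : s ≤ h ^ 2 := by
    have := integral_mono_ae hi2 (integrable_const (h ^ 2)) hsq
    simpa using this
  have hie : Integrable (fun ω => Complex.exp (ξ ω * Complex.I)) P :=
    .of_bound (by fun_prop) 1 (by simp [Complex.norm_exp_ofReal_mul_I])
  have hiq : Integrable (fun ω => (1 : ℂ) + ξ ω * Complex.I - (ξ ω ^ 2 / 2 : ℝ)) P :=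
    ((integrable_const _).add (hi1.ofReal.mul_const _)).sub (hi2.div_const 2).ofReal
  have hq : ∫ ω, ((1 : ℂ) + ξ ω * Complex.I - (ξ ω ^ 2 / 2 : ℝ)) ∂P = 1 - (s / 2 : ℝ) := by
    rw [integral_sub ((integrable_const _).add (hi1.ofReal.mul_const _)) (hi2.div_const 2).ofReal,
      integral_add (integrable_const _) (hi1.ofReal.mul_const _), integral_mul_const,
      integral_complex_ofReal, integral_complex_ofReal, h0, integral_div, ← hs]
    simp
  have hc : charFun (P.map ξ) 1 = ∫ ω, Complex.exp (ξ ω * Complex.I) ∂P := by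
    rw [charFun_apply_real, integral_map hξ (by fun_prop)]
    simp
  have e1 : ‖charFun (P.map ξ) 1 - (1 - (s / 2 : ℝ))‖ ≤ h / 2 * s := by
    rw [hc, ← hq, ← integral_sub hie hiq]
    calc _ ≤ ∫ ω, h / 2 * ξ ω ^ 2 ∂P := by
          refine norm_integral_le_of_norm_le (hi2.const_mul _) ?_
          filter_upwards [hb] with ω hω
          exact norm_exp_mul_I_sub_quadratic_le hω h1
      _ = h / 2 * s := by rw [integral_const_mul]
  -- The error is at most `s²/4`, and `s ≤ h² ≤ h` turns it into a multiple of `h s`.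
  have e2 : ‖((1 : ℂ) - (s / 2 : ℝ)) - Complex.exp (-(s : ℝ) / 2)‖ ≤ h / 2 * s := by
    have hs1 : s ≤ 1 := hsh.trans (pow_le_one₀ hh h1)
    have := Real.abs_exp_sub_one_sub_id_le (x := -s / 2) (by rw [abs_le]; constructor <;> linarith)
    have e : ((1 : ℂ) - (s / 2 : ℝ)) - Complex.exp (-(s : ℝ) / 2)
        = ((-(Real.exp (-s / 2) - 1 - -s / 2) : ℝ) : ℂ) := by
      push_cast
      ring
    rw [e, Complex.norm_real, norm_neg, Real.norm_eq_abs]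
    refine this.trans ?_
    have : s * s ≤ h ^ 2 * s := by gcongr
    have : h ^ 2 * s ≤ h * s := by gcongr; nlinarith
    nlinarith
  calc _ ≤ _ := norm_sub_le_norm_sub_add_norm_sub _ ((1 : ℂ) - (s / 2 : ℝ)) _
    _ ≤ h / 2 * s + h / 2 * s := add_le_add e1 e2
    _ = _ := by ring

/-- A quantitative Lindeberg estimate for sums of independent bounded centered variables. -/
lemma norm_charFun_sum_sub_exp_le {ι : Type*} [Fintype ι] {ξ : ι → Ω → ℝ}
    (hξ : ∀ k, AEMeasurable (ξ k) P) (hind : iIndepFun ξ P) {h : ℝ} (h1 : h ≤ 1)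
    (hb : ∀ k, ∀ᵐ ω ∂P, |ξ k ω| ≤ h) (h0 : ∀ k, ∫ ω, ξ k ω ∂P = 0) :
    ‖charFun (P.map fun ω => ∑ k, ξ k ω) 1
        - Complex.exp (-(∑ k, ∫ ω, ξ k ω ^ 2 ∂P : ℝ) / 2)‖
      ≤ h * ∑ k, ∫ ω, ξ k ω ^ 2 ∂P := by
  have e : Complex.exp (-(∑ k, ∫ ω, ξ k ω ^ 2 ∂P : ℝ) / 2)
      = ∏ k, Complex.exp (-(∫ ω, ξ k ω ^ 2 ∂P : ℝ) / 2) := by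
    rw [← Complex.exp_sum]
    push_cast
    rw [← Finset.sum_div, Finset.sum_neg_distrib]
  rw [hind.charFun_map_fun_sum_eq_prod hξ, e, Finset.mul_sum, Finset.prod_apply]
  refine (norm_prod_sub_prod_le _ _ _ (fun k _ => ?_) fun k _ => ?_).trans
    (Finset.sum_le_sum fun k _ => norm_charFun_sub_exp_le (hξ k) h1 (hb k) (h0 k))
  · have := Measure.isProbabilityMeasure_map (hξ k)
    exact norm_charFun_le_one (μ := P.map (ξ k)) _
  · have : 0 ≤ ∫ ω, ξ k ω ^ 2 ∂P := integral_nonneg fun _ => sq_nonneg _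
    rw [Complex.norm_exp]
    simp only [Complex.div_ofNat_re, Complex.neg_re, Complex.ofReal_re]
    exact Real.exp_le_one_iff.2 (by linarith)

end CharFun

-- Matrix square roots and standardization

section SquareRoot

open scoped RealInnerProductSpace

variable {C : Matrix (Fin 2) (Fin 2) ℝ}

lemma isUnit_sqrt (hC : C.PosDef) : IsUnit (CFC.sqrt C) :=
  (CFC.isUnit_sqrt_iff C hC.posSemidef.nonneg).2 hC.isUnit

lemma isHermitian_sqrt (C : Matrix (Fin 2) (Fin 2) ℝ) : (CFC.sqrt C).IsHermitian :=
  (CFC.sqrt_nonneg C).isSelfAdjoint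

lemma inner_toEuclideanCLM_left {A : Matrix (Fin 2) (Fin 2) ℝ} (hA : A.IsHermitian)
    (x y : EuclideanSpace ℝ (Fin 2)) :
    ⟪toEuclideanCLM (𝕜 := ℝ) A x, y⟫ = ⟪x, toEuclideanCLM (𝕜 := ℝ) A y⟫ := by
  have h : IsSelfAdjoint (toEuclideanCLM (𝕜 := ℝ) A) := IsSelfAdjoint.map hA _
  conv_lhs => rw [← h.adjoint_eq]
  exact ContinuousLinearMap.adjoint_inner_left _ _ _

lemma toEuclideanCLM_mul_apply (A B : Matrix (Fin 2) (Fin 2) ℝ) (x : EuclideanSpace ℝ (Fin 2)) :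
    toEuclideanCLM (𝕜 := ℝ) (A * B) x
      = toEuclideanCLM (𝕜 := ℝ) A (toEuclideanCLM (𝕜 := ℝ) B x) := by
  rw [map_mul]; rfl

lemma add_toEuclideanCLM_sqrt_standardize (hC : C.PosDef) (u x : EuclideanSpace ℝ (Fin 2)) :
    u + toEuclideanCLM (𝕜 := ℝ) (CFC.sqrt C) (standardize u C x) = x := by
  rw [standardize, ← toEuclideanCLM_mul_apply,
    Matrix.mul_nonsing_inv _ ((Matrix.isUnit_iff_isUnit_det _).1 (isUnit_sqrt hC))]
  simp

lemma norm_sq_toEuclideanCLM_sqrt (hC : C.PosDef) (x : EuclideanSpace ℝ (Fin 2)) :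
    ‖toEuclideanCLM (𝕜 := ℝ) (CFC.sqrt C) x‖ ^ 2 = ⟪x, toEuclideanCLM (𝕜 := ℝ) C x⟫ := by
  rw [← real_inner_self_eq_norm_sq, inner_toEuclideanCLM_left (isHermitian_sqrt C),
    ← toEuclideanCLM_mul_apply, CFC.sqrt_mul_sqrt_self _ hC.posSemidef.nonneg]

lemma lipschitzWith_sqrt (hC : C.PosDef)
    (h : ∀ x, ⟪x, toEuclideanCLM (𝕜 := ℝ) C x⟫ ≤ ‖x‖ ^ 2) (u : EuclideanSpace ℝ (Fin 2)) :
    LipschitzWith 1 fun x => u + toEuclideanCLM (𝕜 := ℝ) (CFC.sqrt C) x := by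
  refine LipschitzWith.of_dist_le_mul fun x y => ?_
  rw [dist_add_left, dist_eq_norm, ← map_sub, dist_eq_norm, NNReal.coe_one, one_mul]
  exact le_of_sq_le_sq ((norm_sq_toEuclideanCLM_sqrt hC _).trans_le (h _)) (norm_nonneg _)

/-- For a vector with covariance `C`, this is the variance of its standardization in direction `t`.
-/
lemma inner_inv_sqrt (hC : C.PosDef) (t : EuclideanSpace ℝ (Fin 2)) :
    ⟪toEuclideanCLM (𝕜 := ℝ) (CFC.sqrt C)⁻¹ t,
      toEuclideanCLM (𝕜 := ℝ) C (toEuclideanCLM (𝕜 := ℝ) (CFC.sqrt C)⁻¹ t)⟫ = ‖t‖ ^ 2 := by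
  rw [← norm_sq_toEuclideanCLM_sqrt hC, ← toEuclideanCLM_mul_apply,
    Matrix.mul_nonsing_inv _ ((Matrix.isUnit_iff_isUnit_det _).1 (isUnit_sqrt hC))]
  simp

lemma inner_standardize (u x t : EuclideanSpace ℝ (Fin 2)) :
    ⟪standardize u C x, t⟫ = ⟪x - u, toEuclideanCLM (𝕜 := ℝ) (CFC.sqrt C)⁻¹ t⟫ :=
  inner_toEuclideanCLM_left (isHermitian_sqrt C).inv _ _

lemma continuous_standardize (u : EuclideanSpace ℝ (Fin 2)) (C : Matrix (Fin 2) (Fin 2) ℝ) :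
    Continuous (standardize u C) := by
  unfold standardize
  fun_prop

/-- A multivariate Gaussian and a measure `ν` are no farther apart, in the Lévy-Prokhorov
distance, than the standard Gaussian and the standardization of `ν`, if the covariance matrix is
at most the identity. -/
lemma levyProkhorovDist_multivariateGaussian_le (hC : C.PosDef)
    (h : ∀ x, ⟪x, toEuclideanCLM (𝕜 := ℝ) C x⟫ ≤ ‖x‖ ^ 2) (u : EuclideanSpace ℝ (Fin 2))
    (ν : Measure (EuclideanSpace ℝ (Fin 2))) [IsFiniteMeasure ν] :
    levyProkhorovDist ν (multivariateGaussian u C)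
      ≤ levyProkhorovDist (ν.map (standardize u C)) (stdGaussian (EuclideanSpace ℝ (Fin 2))) := by
  have hL := lipschitzWith_sqrt hC h u
  -- Both measures are images under one 1-Lipschitz affine map: `ν` of its standardization, the
  -- Gaussian of `stdGaussian` by definition.
  have e : ν = (ν.map (standardize u C)).map
      fun x => u + toEuclideanCLM (𝕜 := ℝ) (CFC.sqrt C) x := by
    rw [Measure.map_map hL.continuous.measurable (continuous_standardize u C).measurable]
    simp [Function.comp_def, add_toEuclideanCLM_sqrt_standardize hC]
  conv_lhs => rw [e, multivariateGaussian]
  exact levyProkhorovDist_map_le hL _ _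

end SquareRoot

-- Weighted sums of independent one-bit variables

section OneBitSum

open scoped RealInnerProductSpace

variable {κ Ω : Type*} [MeasurableSpace Ω] {P : Measure Ω} {G : κ → Ω → ℝ} (x : κ → ℝ)

lemma aemeasurable_sign_add (hG : ∀ k, HasLaw (G k) (gaussianReal 0 1) P) (k : κ) :
    AEMeasurable (fun ω => Real.sign (x k + G k ω)) P :=
  measurable_sign.comp_aemeasurable ((hG k).aemeasurable.const_add (x k))

lemma iIndepFun_sign_add (hind : iIndepFun G P) :
    iIndepFun (fun k ω => Real.sign (x k + G k ω)) P :=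
  hind.comp (fun k y => Real.sign (x k + y)) fun _ => measurable_sign.comp (measurable_const_add _)

variable [IsProbabilityMeasure P]

lemma memLp_sign_add (hG : ∀ k, HasLaw (G k) (gaussianReal 0 1) P) (k : κ) :
    MemLp (fun ω => Real.sign (x k + G k ω)) 2 P :=
  .of_bound (aemeasurable_sign_add x hG k).aestronglyMeasurable 1
    (ae_of_all _ fun _ => abs_sign_le_one _)

lemma integral_sign_add_sub_sq (hG : ∀ k, HasLaw (G k) (gaussianReal 0 1) P) (k : κ) :
    ∫ ω, (Real.sign (x k + G k ω) - (1 - 2 * gaussQ (x k))) ^ 2 ∂P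
      = 1 - (1 - 2 * gaussQ (x k)) ^ 2 := by
  have hi := (memLp_sign_add x hG k).integrable one_le_two
  set c := 1 - 2 * gaussQ (x k) with hc
  have e : ∀ᵐ ω ∂P, (Real.sign (x k + G k ω) - c) ^ 2
      = (1 + c ^ 2) - 2 * c * Real.sign (x k + G k ω) := by
    filter_upwards [ae_sign_add_sq_eq_one (hG k) (x k)] with ω hω
    linear_combination hω
  rw [integral_congr_ae e, integral_sub (integrable_const _) (hi.const_mul _),
    integral_const_mul, integral_sign_add (hG k), ← hc]
  simp
  ring

lemma variance_sign_add (hG : ∀ k, HasLaw (G k) (gaussianReal 0 1) P) (k : κ) :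
    Var[fun ω => Real.sign (x k + G k ω); P] = 1 - (1 - 2 * gaussQ (x k)) ^ 2 := by
  rw [variance_eq_integral (aemeasurable_sign_add x hG k), integral_sign_add (hG k),
    integral_sign_add_sub_sq x hG]

variable [Fintype κ] (v : κ → EuclideanSpace ℝ (Fin 2))

lemma memLp_sum_sign_smul (hG : ∀ k, HasLaw (G k) (gaussianReal 0 1) P) :
    MemLp (fun ω => ∑ k, Real.sign (x k + G k ω) • v k) 2 P :=
  memLp_finsetSum _ fun k _ =>
    .of_bound ((aemeasurable_sign_add x hG k).smul_const _).aestronglyMeasurable ‖v k‖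
      (ae_of_all _ fun _ => by
        rw [norm_smul]
        exact mul_le_of_le_one_left (norm_nonneg _) (abs_sign_le_one _))

lemma integral_sum_sign_smul (hG : ∀ k, HasLaw (G k) (gaussianReal 0 1) P) :
    ∫ ω, ∑ k, Real.sign (x k + G k ω) • v k ∂P = ∑ k, (1 - 2 * gaussQ (x k)) • v k := by
  rw [integral_finsetSum _ fun k _ => ((memLp_sign_add x hG k).integrable one_le_two).smul_const _]
  simp_rw [integral_smul_const, integral_sign_add (hG _)]

lemma covariance_sum_sign_smul (hG : ∀ k, HasLaw (G k) (gaussianReal 0 1) P)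
    (hind : iIndepFun G P) (i j : Fin 2) :
    cov[fun ω => (∑ k, Real.sign (x k + G k ω) • v k) i,
        fun ω => (∑ k, Real.sign (x k + G k ω) • v k) j; P]
      = ∑ k, (1 - (1 - 2 * gaussQ (x k)) ^ 2) * (v k i * v k j) := by
  classical
  have e (i : Fin 2) : (fun ω => (∑ k, Real.sign (x k + G k ω) • v k) i)
      = fun ω => ∑ k, Real.sign (x k + G k ω) * v k i := by
    ext ω; simp
  have hm (i : Fin 2) (k : κ) : MemLp (fun ω => Real.sign (x k + G k ω) * v k i) 2 P :=
    (memLp_sign_add x hG k).mul_const _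
  rw [e, e, covariance_fun_sum_fun_sum (hm i) (hm j)]
  refine Finset.sum_congr rfl fun k _ => ?_
  rw [Finset.sum_eq_single k]
  · rw [covariance_mul_const_left, covariance_mul_const_right,
      covariance_self (aemeasurable_sign_add x hG k), variance_sign_add x hG]
    ring
  · intro l _ hl
    rw [covariance_mul_const_left, covariance_mul_const_right,
      ((iIndepFun_sign_add x hind).indepFun hl.symm).covariance_eq_zero (memLp_sign_add x hG k)
        (memLp_sign_add x hG l)]
    simp
  · simp

/-- The characteristic function of the centered one-bit sum is close to the Gaussian one. -/
lemma norm_charFun_standardize_sub_exp_le (hG : ∀ k, HasLaw (G k) (gaussianReal 0 1) P)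
    (hind : iIndepFun G P) {C : Matrix (Fin 2) (Fin 2) ℝ} (hC : C.PosDef)
    (hquad : ∀ s, ⟪s, toEuclideanCLM (𝕜 := ℝ) C s⟫
      = ∑ k, (1 - (1 - 2 * gaussQ (x k)) ^ 2) * ⟪v k, s⟫ ^ 2)
    {δ b : ℝ} (hδ : 0 < δ) (hlow : ∀ s, δ * ‖s‖ ^ 2 ≤ ⟪s, toEuclideanCLM (𝕜 := ℝ) C s⟫)
    (hb : ∀ k, ‖v k‖ ≤ b) (t : EuclideanSpace ℝ (Fin 2)) (ht : 2 * b * (‖t‖ / √δ) ≤ 1) :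
    ‖charFun (P.map fun ω => standardize (∑ k, (1 - 2 * gaussQ (x k)) • v k) C
          (∑ k, Real.sign (x k + G k ω) • v k)) t - Complex.exp (-‖t‖ ^ 2 / 2)‖
      ≤ 2 * b * (‖t‖ / √δ) * ‖t‖ ^ 2 := by
  -- Moving `C^{-1/2}` onto the test vector reduces the claim to a scalar sum of independent
  -- variables with total variance `‖t‖²`.
  set s := toEuclideanCLM (𝕜 := ℝ) (CFC.sqrt C)⁻¹ t with hs
  have hst : ⟪s, toEuclideanCLM (𝕜 := ℝ) C s⟫ = ‖t‖ ^ 2 := inner_inv_sqrt hC t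
  have hsn : ‖s‖ ≤ ‖t‖ / √δ := by
    rw [le_div_iff₀ (Real.sqrt_pos.2 hδ)]
    refine le_of_sq_le_sq ?_ (norm_nonneg _)
    rw [mul_pow, Real.sq_sqrt hδ.le, mul_comm, ← hst]
    exact hlow s
  set ξ : κ → Ω → ℝ :=
    fun k ω => (Real.sign (x k + G k ω) - (1 - 2 * gaussQ (x k))) * ⟪v k, s⟫ with hξ
  have hξm (k : κ) : AEMeasurable (ξ k) P :=
    ((aemeasurable_sign_add x hG k).sub_const _).mul_const _
  have hξi : iIndepFun ξ P :=
    (iIndepFun_sign_add x hind).comp (fun k y => (y - (1 - 2 * gaussQ (x k))) * ⟪v k, s⟫)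
      fun k => by fun_prop
  have hξ2 (k : κ) : ∫ ω, ξ k ω ^ 2 ∂P = (1 - (1 - 2 * gaussQ (x k)) ^ 2) * ⟪v k, s⟫ ^ 2 := by
    simp_rw [hξ, mul_pow]
    rw [integral_mul_const, integral_sign_add_sub_sq x hG]
  have hξ0 (k : κ) : ∫ ω, ξ k ω ∂P = 0 := by
    rw [integral_mul_const, integral_sub ((memLp_sign_add x hG k).integrable one_le_two)
      (integrable_const _), integral_sign_add (hG k)]
    simp
  have hξb (k : κ) (ω : Ω) : |ξ k ω| ≤ 2 * b * (‖t‖ / √δ) := by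
    have h1 := abs_le.1 (abs_sign_le_one (x k + G k ω))
    have h2 := gaussQ_pos (x k)
    have h3 := gaussQ_lt_one (x k)
    -- The sign and its mean both lie in `[-1, 1]`; this is the factor `2` in the bound.
    have h4 : |Real.sign (x k + G k ω) - (1 - 2 * gaussQ (x k))| ≤ 2 := by
      rw [abs_le]; constructor <;> linarith
    have h5 : |⟪v k, s⟫| ≤ b * (‖t‖ / √δ) := (abs_real_inner_le_norm _ _).trans
      (mul_le_mul (hb k) hsn (norm_nonneg _) ((norm_nonneg _).trans (hb k)))
    rw [hξ, abs_mul, mul_assoc]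
    exact mul_le_mul h4 h5 (abs_nonneg _) zero_le_two
  have key := norm_charFun_sum_sub_exp_le hξm hξi ht (fun k => ae_of_all _ (hξb k)) hξ0
  have hw : AEMeasurable (fun ω => standardize (∑ k, (1 - 2 * gaussQ (x k)) • v k) C
      (∑ k, Real.sign (x k + G k ω) • v k)) P :=
    (continuous_standardize _ _).measurable.comp_aemeasurable
      (memLp_sum_sign_smul x v hG).1.aemeasurable
  simp_rw [hξ2] at key
  rw [← hquad, hst] at key
  have e : charFun (P.map fun ω => standardize (∑ k, (1 - 2 * gaussQ (x k)) • v k) C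
      (∑ k, Real.sign (x k + G k ω) • v k)) t = charFun (P.map fun ω => ∑ k, ξ k ω) 1 := by
    rw [charFun_apply, integral_map hw (by fun_prop), charFun_apply_real,
      integral_map (Finset.aemeasurable_fun_sum _ fun k _ => hξm k) (by fun_prop)]
    congr 1
    ext ω
    rw [inner_standardize, ← hs, ← Finset.sum_sub_distrib, sum_inner]
    simp [hξ, ← sub_smul, real_inner_smul_left]
  rw [e]
  simpa using key

end OneBitSum

-- The radar statistic as a one-bit sum

section Statistic

open scoped RealInnerProductSpace

variable {m n : ℕ}

/-- The noise-free inputs of the one-bit quantizers of the real and imaginary parts. -/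
def shift (β : ℂ) (Z : Matrix (Fin m) (Fin n) ℂ) : (Fin m × Fin n) ⊕ (Fin m × Fin n) → ℝ :=
  Sum.elim (fun k => β.re * (Z k.1 k.2).re - β.im * (Z k.1 k.2).im)
    (fun k => β.re * (Z k.1 k.2).im + β.im * (Z k.1 k.2).re)

/-- The coefficients of the quantized real and imaginary parts in the statistic `w`. -/
def direction (Z : Matrix (Fin m) (Fin n) ℂ) :
    (Fin m × Fin n) ⊕ (Fin m × Fin n) → EuclideanSpace ℝ (Fin 2) :=
  Sum.elim (fun k => (1 / √((m : ℝ) * n)) • !₂[(Z k.1 k.2).re, -(Z k.1 k.2).im])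
    (fun k => (1 / √((m : ℝ) * n)) • !₂[(Z k.1 k.2).im, (Z k.1 k.2).re])

/-- The real and imaginary parts of the entries of a matrix. -/
def realParts (W : Matrix (Fin m) (Fin n) ℂ) : (Fin m × Fin n) ⊕ (Fin m × Fin n) → ℝ :=
  Sum.elim (fun k => (W k.1 k.2).re) (fun k => (W k.1 k.2).im)

section Coordinates

variable (β : ℂ) (Z : Matrix (Fin m) (Fin n) ℂ) (k : Fin m × Fin n)

@[simp] lemma shift_inl : shift β Z (.inl k) = β.re * (Z k.1 k.2).re - β.im * (Z k.1 k.2).im := rfl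

@[simp] lemma shift_inr : shift β Z (.inr k) = β.re * (Z k.1 k.2).im + β.im * (Z k.1 k.2).re := rfl

@[simp] lemma realParts_inl : realParts Z (.inl k) = (Z k.1 k.2).re := rfl

@[simp] lemma realParts_inr : realParts Z (.inr k) = (Z k.1 k.2).im := rfl

@[simp] lemma direction_inl_zero :
    direction Z (.inl k) 0 = 1 / √((m : ℝ) * n) * (Z k.1 k.2).re := rfl

@[simp] lemma direction_inl_one :
    direction Z (.inl k) 1 = 1 / √((m : ℝ) * n) * -(Z k.1 k.2).im := rfl

@[simp] lemma direction_inr_zero :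
    direction Z (.inr k) 0 = 1 / √((m : ℝ) * n) * (Z k.1 k.2).im := rfl

@[simp] lemma direction_inr_one :
    direction Z (.inr k) 1 = 1 / √((m : ℝ) * n) * (Z k.1 k.2).re := rfl

lemma one_sub_two_mul_gaussQ_shift_inl :
    1 - 2 * gaussQ (shift β Z (.inl k)) = cCoef β (Z k.1 k.2) := rfl

lemma one_sub_two_mul_gaussQ_shift_inr :
    1 - 2 * gaussQ (shift β Z (.inr k)) = dCoef β (Z k.1 k.2) := rfl

end Coordinates

lemma sum_vec {M : Type*} [AddCommMonoid M] (Z : Matrix (Fin m) (Fin n) ℂ) (f : ℂ → M) :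
    ∑ k, f (vec Z k) = ∑ k : Fin m × Fin n, f (Z k.1 k.2) :=
  Fintype.sum_equiv (Equiv.prodComm _ _) _ _ fun _ => rfl

lemma wStat_quantize_eq_sum (β : ℂ) (Z W : Matrix (Fin m) (Fin n) ℂ) :
    wStat Z (quantize (β • Z + W))
      = ∑ k, Real.sign (shift β Z k + realParts W k) • direction Z k := by
  have e (Y : Matrix (Fin m) (Fin n) ℂ) :
      star (vec Z) ⬝ᵥ vec Y = ∑ k : Fin m × Fin n, star (Z k.1 k.2) * Y k.1 k.2 :=
    Fintype.sum_equiv (Equiv.prodComm _ _) _ _ fun _ => rfl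
  rw [Fintype.sum_sum_type, ← Finset.sum_add_distrib]
  ext i
  fin_cases i
  · change (star (vec Z) ⬝ᵥ vec (quantize (β • Z + W))).re / √((m : ℝ) * n) = _
    rw [e, Complex.re_sum, Finset.sum_div, WithLp.ofLp_sum, Finset.sum_apply]
    refine Finset.sum_congr rfl fun k _ => ?_
    simp [quantize]
    ring
  · change (star (vec Z) ⬝ᵥ vec (quantize (β • Z + W))).im / √((m : ℝ) * n) = _
    rw [e, Complex.im_sum, Finset.sum_div, WithLp.ofLp_sum, Finset.sum_apply]
    refine Finset.sum_congr rfl fun k _ => ?_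
    simp [quantize]
    ring

lemma meanW_eq_sum (β : ℂ) (Z : Matrix (Fin m) (Fin n) ℂ) :
    meanW β Z = ∑ k, (1 - 2 * gaussQ (shift β Z k)) • direction Z k := by
  rw [Fintype.sum_sum_type, ← Finset.sum_add_distrib]
  ext i
  fin_cases i
  · change 1 / √((m : ℝ) * n) *
      ∑ k, (cCoef β (vec Z k) * (vec Z k).re + dCoef β (vec Z k) * (vec Z k).im) = _
    rw [sum_vec Z fun z => cCoef β z * z.re + dCoef β z * z.im, Finset.mul_sum,
      WithLp.ofLp_sum, Finset.sum_apply]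
    refine Finset.sum_congr rfl fun k _ => ?_
    rw [one_sub_two_mul_gaussQ_shift_inl, one_sub_two_mul_gaussQ_shift_inr]
    simp
    ring
  · change 1 / √((m : ℝ) * n) *
      ∑ k, (dCoef β (vec Z k) * (vec Z k).re - cCoef β (vec Z k) * (vec Z k).im) = _
    rw [sum_vec Z fun z => dCoef β z * z.re - cCoef β z * z.im, Finset.mul_sum,
      WithLp.ofLp_sum, Finset.sum_apply]
    refine Finset.sum_congr rfl fun k _ => ?_
    rw [one_sub_two_mul_gaussQ_shift_inl, one_sub_two_mul_gaussQ_shift_inr]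
    simp
    ring

variable {β : ℂ} {Z : Matrix (Fin m) (Fin n) ℂ}

lemma sum_sq_add_sq_eq (htr : (Z * Zᴴ).trace = (m : ℂ) * n) :
    ∑ k : Fin m × Fin n, ((Z k.1 k.2).re ^ 2 + (Z k.1 k.2).im ^ 2) = (m : ℝ) * n := by
  have h := congrArg Complex.re htr
  rw [Matrix.trace] at h
  simp only [Matrix.diag, Matrix.mul_apply, conjTranspose_apply] at h
  rw [Fintype.sum_prod_type]
  simpa [sq] using h

lemma inv_sqrt_sq (hmn : 0 < (m : ℝ) * n) : (1 / √((m : ℝ) * n)) ^ 2 = 1 / ((m : ℝ) * n) := by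
  rw [div_pow, Real.sq_sqrt hmn.le, one_pow]

/-- The leading `1` in `σ₁²` and `σ₂²` is `N⁻¹ ∑ |z|²` by the trace normalization; in `σ₁₂` the
corresponding terms cancel between real and imaginary parts. -/
lemma covW_eq_sum (hmn : 0 < (m : ℝ) * n) (htr : (Z * Zᴴ).trace = (m : ℂ) * n) (i j : Fin 2) :
    covW β Z i j = ∑ k, (1 - (1 - 2 * gaussQ (shift β Z k)) ^ 2)
      * (direction Z k i * direction Z k j) := by
  have h1 : (1 : ℝ) = 1 / ((m : ℝ) * n) *
      ∑ k : Fin m × Fin n, ((Z k.1 k.2).re ^ 2 + (Z k.1 k.2).im ^ 2) := by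
    rw [sum_sq_add_sq_eq htr, one_div_mul_cancel hmn.ne']
  have h12 : sigma12 β Z = ∑ k, (1 - (1 - 2 * gaussQ (shift β Z k)) ^ 2)
      * (direction Z k 0 * direction Z k 1) := by
    rw [sigma12, sum_vec Z fun z => (cCoef β z ^ 2 - dCoef β z ^ 2) * z.re * z.im,
      Finset.mul_sum, Fintype.sum_sum_type, ← Finset.sum_add_distrib]
    refine Finset.sum_congr rfl fun k _ => ?_
    rw [one_sub_two_mul_gaussQ_shift_inl, one_sub_two_mul_gaussQ_shift_inr, direction_inl_zero,
      direction_inl_one, direction_inr_zero, direction_inr_one, ← inv_sqrt_sq hmn]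
    ring
  have h11 : sigma1Sq β Z = ∑ k, (1 - (1 - 2 * gaussQ (shift β Z k)) ^ 2)
      * (direction Z k 0 * direction Z k 0) := by
    rw [sigma1Sq, sum_vec Z fun z => cCoef β z ^ 2 * z.re ^ 2 + dCoef β z ^ 2 * z.im ^ 2,
      sub_eq_iff_eq_add]
    refine h1.trans ?_
    rw [Finset.mul_sum, Finset.mul_sum, Fintype.sum_sum_type, ← Finset.sum_add_distrib,
      ← Finset.sum_add_distrib]
    refine Finset.sum_congr rfl fun k _ => ?_
    rw [one_sub_two_mul_gaussQ_shift_inl, one_sub_two_mul_gaussQ_shift_inr, direction_inl_zero,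
      direction_inr_zero, ← inv_sqrt_sq hmn]
    ring
  have h22 : sigma2Sq β Z = ∑ k, (1 - (1 - 2 * gaussQ (shift β Z k)) ^ 2)
      * (direction Z k 1 * direction Z k 1) := by
    rw [sigma2Sq, sum_vec Z fun z => cCoef β z ^ 2 * z.im ^ 2 + dCoef β z ^ 2 * z.re ^ 2,
      sub_eq_iff_eq_add]
    refine h1.trans ?_
    rw [Finset.mul_sum, Finset.mul_sum, Fintype.sum_sum_type, ← Finset.sum_add_distrib,
      ← Finset.sum_add_distrib]
    refine Finset.sum_congr rfl fun k _ => ?_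
    rw [one_sub_two_mul_gaussQ_shift_inl, one_sub_two_mul_gaussQ_shift_inr, direction_inl_one,
      direction_inr_one, ← inv_sqrt_sq hmn]
    ring
  fin_cases i <;> fin_cases j
  · exact h11
  · exact h12
  · exact h12.trans (Finset.sum_congr rfl fun k _ => by rw [mul_comm (direction Z k 0)]; rfl)
  · exact h22

lemma inner_covW (hmn : 0 < (m : ℝ) * n) (htr : (Z * Zᴴ).trace = (m : ℂ) * n)
    (s : EuclideanSpace ℝ (Fin 2)) :
    ⟪s, toEuclideanCLM (𝕜 := ℝ) (covW β Z) s⟫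
      = ∑ k, (1 - (1 - 2 * gaussQ (shift β Z k)) ^ 2) * ⟪direction Z k, s⟫ ^ 2 := by
  rw [inner_toEuclideanCLM]
  simp only [dotProduct, mulVec, Fin.sum_univ_two, covW_eq_sum hmn htr, Finset.sum_mul,
    Finset.mul_sum, ← Finset.sum_add_distrib, PiLp.inner_apply]
  refine Finset.sum_congr rfl fun k _ => ?_
  simp
  ring

/-- The two vectors attached to an entry `z` are orthogonal, both of squared length `|z|²/N`, so
together they contribute `(|z|²/N) ‖s‖²`. -/
lemma sum_inner_direction_sq (hmn : 0 < (m : ℝ) * n) (htr : (Z * Zᴴ).trace = (m : ℂ) * n)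
    (s : EuclideanSpace ℝ (Fin 2)) : ∑ k, ⟪direction Z k, s⟫ ^ 2 = ‖s‖ ^ 2 := by
  have h1 : (1 : ℝ) = 1 / ((m : ℝ) * n) *
      ∑ k : Fin m × Fin n, ((Z k.1 k.2).re ^ 2 + (Z k.1 k.2).im ^ 2) := by
    rw [sum_sq_add_sq_eq htr, one_div_mul_cancel hmn.ne']
  rw [← one_mul (‖s‖ ^ 2), h1, Finset.mul_sum, Finset.sum_mul, Fintype.sum_sum_type,
    ← Finset.sum_add_distrib]
  refine Finset.sum_congr rfl fun k _ => ?_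
  rw [EuclideanSpace.real_norm_sq_eq, ← inv_sqrt_sq hmn]
  simp only [PiLp.inner_apply, Fin.sum_univ_two, direction_inl_zero,
      direction_inl_one, direction_inr_zero, direction_inr_one, RCLike.inner_apply, conj_trivial]
  ring

lemma inner_covW_le (hmn : 0 < (m : ℝ) * n) (htr : (Z * Zᴴ).trace = (m : ℂ) * n)
    (s : EuclideanSpace ℝ (Fin 2)) :
    ⟪s, toEuclideanCLM (𝕜 := ℝ) (covW β Z) s⟫ ≤ ‖s‖ ^ 2 := by
  rw [inner_covW hmn htr, ← sum_inner_direction_sq hmn htr]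
  refine Finset.sum_le_sum fun k _ => mul_le_of_le_one_left (sq_nonneg _) ?_
  linarith [sq_nonneg (1 - 2 * gaussQ (shift β Z k))]

lemma le_inner_covW (hmn : 0 < (m : ℝ) * n) (htr : (Z * Zᴴ).trace = (m : ℂ) * n) {δ : ℝ}
    (hδ : ∀ k, (1 - 2 * gaussQ (shift β Z k)) ^ 2 ≤ 1 - δ) (s : EuclideanSpace ℝ (Fin 2)) :
    δ * ‖s‖ ^ 2 ≤ ⟪s, toEuclideanCLM (𝕜 := ℝ) (covW β Z) s⟫ := by
  rw [inner_covW hmn htr, ← sum_inner_direction_sq hmn htr, Finset.mul_sum]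
  exact Finset.sum_le_sum fun k _ =>
    mul_le_mul_of_nonneg_right (by linarith [hδ k]) (sq_nonneg _)

lemma posDef_covW (hmn : 0 < (m : ℝ) * n) (htr : (Z * Zᴴ).trace = (m : ℂ) * n) {δ : ℝ}
    (hδ0 : 0 < δ) (hδ : ∀ k, (1 - 2 * gaussQ (shift β Z k)) ^ 2 ≤ 1 - δ) :
    (covW β Z).PosDef := by
  refine Matrix.PosDef.of_dotProduct_mulVec_pos ?_ fun x hx => ?_
  · ext i j
    fin_cases i <;> fin_cases j <;> simp [covW]
  · have h := le_inner_covW hmn htr hδ (WithLp.toLp 2 x)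
    rw [inner_toEuclideanCLM] at h
    refine lt_of_lt_of_le ?_ h
    have : WithLp.toLp 2 x ≠ 0 := by simpa using hx
    positivity

lemma abs_shift_le {B : ℝ} (hB : ∀ i j, ‖Z i j‖ ≤ B) (k : (Fin m × Fin n) ⊕ (Fin m × Fin n)) :
    |shift β Z k| ≤ ‖β‖ * B := by
  rcases k with k | k
  · calc |shift β Z (.inl k)| = |(β * Z k.1 k.2).re| := by simp
      _ ≤ ‖β * Z k.1 k.2‖ := Complex.abs_re_le_norm _
      _ ≤ ‖β‖ * B := by rw [norm_mul]; gcongr; exact hB _ _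
  · calc |shift β Z (.inr k)| = |(β * Z k.1 k.2).im| := by simp
      _ ≤ ‖β * Z k.1 k.2‖ := Complex.abs_im_le_norm _
      _ ≤ ‖β‖ * B := by rw [norm_mul]; gcongr; exact hB _ _

lemma norm_direction_le {B : ℝ} (hB : ∀ i j, ‖Z i j‖ ≤ B)
    (k : (Fin m × Fin n) ⊕ (Fin m × Fin n)) : ‖direction Z k‖ ≤ B / √((m : ℝ) * n) := by
  have h (z : ℂ) : √(z.re ^ 2 + z.im ^ 2) = ‖z‖ := by
    rw [Complex.norm_def, Complex.normSq_apply, sq, sq]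
  rcases k with k | k
  · have : ‖direction Z (.inl k)‖ = 1 / √((m : ℝ) * n) * ‖Z k.1 k.2‖ := by
      rw [← h]
      simp [direction, norm_smul, EuclideanSpace.norm_eq, abs_of_nonneg (Real.sqrt_nonneg _)]
    rw [this, div_mul_eq_mul_div, one_mul]
    gcongr
    exact hB _ _
  · have : ‖direction Z (.inr k)‖ = 1 / √((m : ℝ) * n) * ‖Z k.1 k.2‖ := by
      rw [← h, add_comm]
      simp [direction, norm_smul, EuclideanSpace.norm_eq, abs_of_nonneg (Real.sqrt_nonneg _)]
    rw [this, div_mul_eq_mul_div, one_mul]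
    gcongr
    exact hB _ _

variable {Ω : Type*} [MeasurableSpace Ω] {P : Measure Ω} {W : Ω → Matrix (Fin m) (Fin n) ℂ}

lemma IsWhiteNoise.hasLaw_realParts (hW : IsWhiteNoise P W)
    (k : (Fin m × Fin n) ⊕ (Fin m × Fin n)) :
    HasLaw (fun ω => realParts (W ω) k) (gaussianReal 0 1) P := by
  rcases k with k | k
  exacts [hW.law_re _ _, hW.law_im _ _]

lemma IsWhiteNoise.iIndepFun_realParts (hW : IsWhiteNoise P W) :
    iIndepFun (fun k ω => realParts (W ω) k) P := by
  convert hW.indep using 1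
  ext k ω
  rcases k with k | k <;> rfl

end Statistic

end

end OneBitRadar

-- Assembly of the theorem

open OneBitRadar in
theorem theorem2
    {m p : ℕ} (hm : 1 ≤ m) (β : ℂ)
    (aR : Fin m → ℂ) (aT : Fin p → ℂ)
    (S : (n : ℕ) → Matrix (Fin p) (Fin n) ℂ)
    -- normalization `tr (Z Zᴴ) = N = m n`
    (hnorm : ∀ n, (signal aR aT (S n) * (signal aR aT (S n))ᴴ).trace = (m : ℂ) * n)
    -- the entries of `Z` are bounded uniformly in `n`
    (hbdd : ∃ B : ℝ, ∀ n i j, ‖signal aR aT (S n) i j‖ ≤ B)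
    {Ω : ℕ → Type*} [∀ n, MeasurableSpace (Ω n)]
    (P : (n : ℕ) → Measure (Ω n)) [∀ n, IsProbabilityMeasure (P n)]
    (W : (n : ℕ) → Ω n → Matrix (Fin m) (Fin n) ℂ)
    (hW : ∀ n, IsWhiteNoise (P n) (W n))
    -- the statistic computed from `Y = quantize (β Z + noise)`
    (w : (n : ℕ) → Ω n → EuclideanSpace ℝ (Fin 2))
    (hw : ∀ n ω, w n ω =
      wStat (signal aR aT (S n)) (quantize (β • signal aR aT (S n) + W n ω))) :
    -- exact first and second moments, and nondegeneracy of the covariance matrix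
    (∀ n, 1 ≤ n →
      MemLp (w n) 2 (P n) ∧
      (∫ ω, w n ω ∂(P n)) = meanW β (signal aR aT (S n)) ∧
      (∀ k l : Fin 2, cov[fun ω => w n ω k, fun ω => w n ω l; P n] =
        covW β (signal aR aT (S n)) k l) ∧
      (covW β (signal aR aT (S n))).PosDef) ∧
    -- asymptotic normality of the standardized statistic
    TendstoInDistribution
      (fun n ω => standardize (meanW β (signal aR aT (S n))) (covW β (signal aR aT (S n))) (w n ω))
      atTop (id : EuclideanSpace ℝ (Fin 2) → EuclideanSpace ℝ (Fin 2))
      P (stdGaussian (EuclideanSpace ℝ (Fin 2))) ∧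
    -- the Lévy-Prokhorov distance from the law of `w` to the Gaussian law tends to `0`
    Tendsto
      (fun n => levyProkhorovDist ((P n).map (w n))
        (multivariateGaussian (meanW β (signal aR aT (S n))) (covW β (signal aR aT (S n)))))
      atTop (𝓝 0) := by
  obtain ⟨B, hB⟩ := hbdd
  obtain ⟨δ, hδ0, hδ⟩ := exists_sq_one_sub_two_mul_gaussQ_le (‖β‖ * B)
  set Z := fun n => signal aR aT (S n) with hZ
  have hδ' (n : ℕ) (k) : (1 - 2 * gaussQ (shift β (Z n) k)) ^ 2 ≤ 1 - δ :=
    hδ _ (abs_shift_le (hB n) k)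
  have hmn (n : ℕ) (hn : 1 ≤ n) : 0 < (m : ℝ) * n := by positivity
  have hpos (n : ℕ) (hn : 1 ≤ n) : (covW β (Z n)).PosDef :=
    posDef_covW (hmn n hn) (hnorm n) hδ0 (hδ' n)
  have hG (n : ℕ) := (hW n).hasLaw_realParts
  have hI (n : ℕ) := (hW n).iIndepFun_realParts
  have hw' (n : ℕ) : w n = fun ω =>
      ∑ k, Real.sign (shift β (Z n) k + realParts (W n ω) k) • direction (Z n) k := by
    ext1 ω
    rw [hw, wStat_quantize_eq_sum]
  have hL (n : ℕ) : MemLp (w n) 2 (P n) := by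
    rw [hw']
    exact memLp_sum_sign_smul _ _ (hG n)
  have hst (n : ℕ) : AEMeasurable
      (fun ω => standardize (meanW β (Z n)) (covW β (Z n)) (w n ω)) (P n) :=
    (continuous_standardize _ _).measurable.comp_aemeasurable (hL n).1.aemeasurable
  have hsqrt : Tendsto (fun n : ℕ => √((m : ℝ) * n)) atTop atTop :=
    Real.tendsto_sqrt_atTop.comp
      (tendsto_natCast_atTop_atTop.const_mul_atTop (by positivity))
  have hclt : TendstoInDistribution
      (fun n ω => standardize (meanW β (Z n)) (covW β (Z n)) (w n ω))
      atTop (id : EuclideanSpace ℝ (Fin 2) → EuclideanSpace ℝ (Fin 2))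
      P (stdGaussian (EuclideanSpace ℝ (Fin 2))) := by
    refine ⟨hst, aemeasurable_id, ProbabilityMeasure.tendsto_iff_tendsto_charFun.2 fun t => ?_⟩
    simp only [ProbabilityMeasure.coe_mk, Measure.map_id, charFun_stdGaussian]
    -- This bounds the scalar summands; it vanishes for fixed `t` because `B` and `δ` do not depend
    -- on `n`.
    have hsmall : Tendsto (fun n : ℕ => 2 * (B / √((m : ℝ) * n)) * (‖t‖ / √δ)) atTop (𝓝 0) := by
      simpa using ((hsqrt.const_div_atTop B).const_mul 2).mul_const (‖t‖ / √δ)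
    rw [tendsto_iff_norm_sub_tendsto_zero]
    refine squeeze_zero' (.of_forall fun _ => norm_nonneg _) ?_
      ((zero_mul (‖t‖ ^ 2)) ▸ hsmall.mul_const (‖t‖ ^ 2))
    filter_upwards [eventually_ge_atTop 1, hsmall.eventually_le_const one_pos] with n hn ht
    rw [meanW_eq_sum, hw']
    exact norm_charFun_standardize_sub_exp_le _ _ (hG n) (hI n) (hpos n hn)
      (inner_covW (hmn n hn) (hnorm n)) hδ0 (le_inner_covW (hmn n hn) (hnorm n) (hδ' n))
      (norm_direction_le (hB n)) t ht
  refine ⟨fun n hn => ⟨hL n, ?_, fun i j => ?_, hpos n hn⟩, hclt, ?_⟩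
  · rw [hw', integral_sum_sign_smul _ _ (hG n)]
    exact (meanW_eq_sum _ _).symm
  · rw [hw', covariance_sum_sign_smul _ _ (hG n) (hI n)]
    exact (covW_eq_sum (hmn n hn) (hnorm n) i j).symm
  -- Weak convergence of the standardized laws becomes convergence in the Lévy–Prokhorov distance,
  -- which dominates the distance sought.
  · have h := ((LevyProkhorov.continuous_ofMeasure_probabilityMeasure.tendsto _).comp hclt.tendsto)
    rw [tendsto_iff_dist_tendsto_zero] at h
    refine squeeze_zero' (.of_forall fun _ => ENNReal.toReal_nonneg) ?_ h
    filter_upwards [eventually_ge_atTop 1] with n hn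
    have := Measure.isProbabilityMeasure_map (hL n).1.aemeasurable
    refine (levyProkhorovDist_multivariateGaussian_le (hpos n hn)
      (inner_covW_le (hmn n hn) (hnorm n)) _ _).trans_eq ?_
    rw [AEMeasurable.map_map_of_aemeasurable (continuous_standardize _ _).aemeasurable
      (hL n).1.aemeasurable]
    change _ = levyProkhorovDist _ ((stdGaussian (EuclideanSpace ℝ (Fin 2))).map id)
    rw [Measure.map_id]
    rfl
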